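/- A \emph{connectivity space} is a pair $(X,\mathcal K)$, where $X$ is a set of points and $\mathcal K$ is a set of subsets of $X$, called \emph{connected}, such that $\emptyset\in\mathcal K$ and the union of every family of connected subsets with non-empty intersection is connected (singletons need not be connected). It is \emph{finite} if $X$ is finite. For a set $\mathcal C$ of subsets of $X$, let $[\mathcal C]$ denote the smallest connectivity structure on $X$ containing $\mathcal C$. The poset $(\mathcal K,\subseteq)$, viewed as a category, carries the Grothendieck topology $J$ for which a sieve on $A\in\mathcal K$, with domain $\dot\sigma\subseteq\{B\in\mathcal K : B\subseteq A\}$, is covering if and only if $[\dot\sigma]=\{B\in\mathcal K : B\subseteq A\}$. Put $Sh(X,\mathcal K)=Sh(\mathcal K,J)$, the category of sheaves of sets on this site, and for a topological space $E$ let $Sh(E)$ be the category of sheaves of sets on $E$. Two such spaces (connectivity or topological) are \emph{Morita-equivalent} if their categories of sheaves of sets are equivalent. A topological space is \emph{sober} if every irreducible closed subset is the closure of exactly one point. (1) For every finite connectivity space $(X,\mathcal K)$ there is a finite sober topological space $E$ that is Morita-equivalent to $(X,\mathcal K)$, and every finite sober topological space that is Morita-equivalent to $(X,\mathcal K)$ is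 homeomorphic to $E$. (2) Conversely, every finite topological space (sober or not) is Morita-equivalent to some finite connectivity space. -/

import Mathlib

open CategoryTheory TopologicalSpace

universe u v w

/-- A connectivity structure on a set of points `X`: a set of subsets of `X`, called connected,
which contains the empty set and the union of every family of connected subsets whose intersection
is non-empty. Singletons are not required to be connected. -/
structure ConnectivityStructure (X : Type u) where
  /-- The connected subsets of `X`. -/
  connected : Set (Set X)
  empty_mem : ∅ ∈ connected
  sUnion_mem : ∀ F : Set (Set X), F ⊆ connected → (⋂₀ F).Nonempty → ⋃₀ F ∈ connected

namespace ConnectivityStructure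

variable {X : Type u}

/-- The connectivity structure generated by a set `C` of subsets of `X`: the smallest one (for
inclusion) that contains `C`. -/
def generate (C : Set (Set X)) : ConnectivityStructure X where
  connected := {A | ∀ L : ConnectivityStructure X, C ⊆ L.connected → A ∈ L.connected}
  empty_mem := fun L _ => L.empty_mem
  sUnion_mem := fun F hF hne L hL => L.sUnion_mem F (fun _ hA => hF hA L hL) hne

theorem subset_generate (C : Set (Set X)) : C ⊆ (generate C).connected :=
  fun _ hA _ hL => hL hA

theorem generate_subset {C : Set (Set X)} {L : ConnectivityStructure X} (h : C ⊆ L.connected) :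
    (generate C).connected ⊆ L.connected :=
  fun _ hA => hA L h

theorem generate_mono {C D : Set (Set X)} (h : C ⊆ D) :
    (generate C).connected ⊆ (generate D).connected :=
  generate_subset (h.trans (subset_generate D))

/-- A connected set of the generated structure which is contained in `B` is already generated by
those generators which are contained in `B`. -/
theorem generate_inter_powerset (C : Set (Set X)) (B : Set X) :
    (generate (C ∩ 𝒫 B)).connected = (generate C).connected ∩ 𝒫 B := by
  apply Set.Subset.antisymm
  · intro A hA
    refine ⟨generate_mono Set.inter_subset_left hA, ?_⟩
    exact hA ⟨𝒫 B, Set.empty_subset B, fun F hF _ => Set.sUnion_subset hF⟩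
      Set.inter_subset_right
  · rintro A ⟨hA, hAB⟩
    have key := hA ⟨(generate (C ∩ 𝒫 B)).connected ∪ {D | ¬ D ⊆ B},
      Or.inl (generate (C ∩ 𝒫 B)).empty_mem, fun F hF hne => by
        by_cases hB : ⋃₀ F ⊆ B
        · left
          refine (generate (C ∩ 𝒫 B)).sUnion_mem F (fun D hD => ?_) hne
          rcases hF hD with h | h
          · exact h
          · exact absurd ((Set.subset_sUnion_of_mem hD).trans hB) h
        · exact Or.inr hB⟩ (fun D hD => by
        by_cases hB : D ⊆ B
        · exact Or.inl (subset_generate _ ⟨hD, hB⟩)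
        · exact Or.inr hB)
    rcases key with h | h
    · exact h
    · exact absurd hAB h

/-- The connected subsets of `X`, ordered by inclusion; the partial order makes them a small
category, with one arrow `B ⟶ A` exactly when `B ⊆ A`. -/
abbrev Conn (K : ConnectivityStructure X) : Type u := {A : Set X // A ∈ K.connected}

/-- The domain of a sieve on a connected set `A`: the set of the connected `B ⊆ A` that belong to
the sieve. -/
def sieveDom (K : ConnectivityStructure X) {A : K.Conn} (S : Sieve A) : Set (Set X) :=
  {B | ∃ (hB : B ∈ K.connected) (f : (⟨B, hB⟩ : K.Conn) ⟶ A), S f}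

/-- The connectivity structure induced on `A`, as a set of subsets of `X`. -/
def induced (K : ConnectivityStructure X) (A : Set X) : Set (Set X) :=
  K.connected ∩ 𝒫 A

theorem sieveDom_subset (K : ConnectivityStructure X) {A : K.Conn} (S : Sieve A) :
    K.sieveDom S ⊆ K.connected := by
  rintro B ⟨hB, _⟩
  exact hB

theorem sieveDom_subset_induced (K : ConnectivityStructure X) {A : K.Conn} (S : Sieve A) :
    K.sieveDom S ⊆ K.induced A.1 := by
  rintro B ⟨hB, f, _⟩
  exact ⟨hB, leOfHom f⟩

theorem generate_sieveDom_subset (K : ConnectivityStructure X) {A : K.Conn} (S : Sieve A) :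
    (generate (K.sieveDom S)).connected ⊆ K.induced A.1 := by
  have h : K.sieveDom S ∩ 𝒫 A.1 = K.sieveDom S :=
    Set.inter_eq_left.2 fun B hB => (K.sieveDom_subset_induced S hB).2
  rw [← h, generate_inter_powerset]
  exact Set.inter_subset_inter_left _ (generate_subset (K.sieveDom_subset S))

theorem sieveDom_pullback (K : ConnectivityStructure X) {A B : K.Conn} (S : Sieve A) (f : B ⟶ A) :
    K.sieveDom (S.pullback f) = K.sieveDom S ∩ 𝒫 B.1 := by
  ext D
  constructor
  · rintro ⟨hD, g, hg⟩
    exact ⟨⟨hD, g ≫ f, hg⟩, leOfHom g⟩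
  · rintro ⟨⟨hD, g, hg⟩, hDB⟩
    refine ⟨hD, homOfLE hDB, ?_⟩
    have e : homOfLE (show (⟨D, hD⟩ : K.Conn) ≤ B from hDB) ≫ f = g := Subsingleton.elim _ _
    change S _
    rw [e]
    exact hg

/-- The Grothendieck topology of a connectivity space `(X, K)`, on the category of its connected
sets: a sieve on `A` is covering when its domain generates the structure induced on `A`. -/
def grothendieckTopology (K : ConnectivityStructure X) : GrothendieckTopology K.Conn where
  sieves A := {S | (generate (K.sieveDom S)).connected = K.induced A.1}
  top_mem' A := by
    refine Set.Subset.antisymm (K.generate_sieveDom_subset _) fun B hB => ?_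
    exact subset_generate _ ⟨hB.1, homOfLE hB.2, trivial⟩
  pullback_stable' A B S f hS := by
    change _ = _ at hS
    change _ = _
    rw [sieveDom_pullback, generate_inter_powerset, hS]
    have hBA : 𝒫 B.1 ⊆ 𝒫 A.1 := Set.powerset_mono.2 (leOfHom f)
    rw [induced, induced, Set.inter_assoc, Set.inter_eq_right.2 hBA]
  transitive' A S hS R hR := by
    change _ = _ at hS
    refine Set.Subset.antisymm (K.generate_sieveDom_subset _) ?_
    rw [← hS]
    refine generate_subset ?_
    rintro B ⟨hB, f, hf⟩
    have h : (generate (K.sieveDom (R.pullback f))).connected = K.induced B := hR hf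
    rw [sieveDom_pullback] at h
    have hmem : B ∈ K.induced B := ⟨hB, Set.Subset.refl B⟩
    rw [← h] at hmem
    exact generate_mono Set.inter_subset_left hmem

end ConnectivityStructure

/-- Two sites are Morita-equivalent when their categories of sheaves of sets are equivalent. -/
def MoritaEquivalent {C : Type u} [Category.{v} C] (J : GrothendieckTopology C)
    {D : Type u} [Category.{w} D] (J' : GrothendieckTopology D) : Prop :=
  Nonempty (Sheaf J (Type u) ≌ Sheaf J' (Type u))

/-- A topological space is sober when every irreducible closed subset (irreducible sets being
non-empty) is the closure of a point, and this point is unique. -/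
def IsSober (E : Type u) [TopologicalSpace E] : Prop :=
  QuasiSober E ∧ T0Space E

open Opposite

/-! On both kinds of site, the objects whose only covering sieve is maximal already cover every
object, so by the comparison lemma sheaves are presheaves on the preorder they form. For a finite
connectivity space these are the `Irreducible` connected sets; for a finite space, the smallest
neighbourhoods of its points. A finite poset `P` is recovered from its presheaf category, and finite
sober spaces amount to finite posets: this gives (1). For (2), the connectivity structure generated
by the smallest neighbourhoods yields the same preorder as the space. -/

/-- Comparison lemma, for a poset-indexed family of objects without nontrivial covers. -/
theorem nonempty_sheaf_equiv_presheaf {P : Type u} [Preorder P] {C : Type u} [Preorder C]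
    (J : GrothendieckTopology C) (g : P → C) (hg : ∀ p q, g p ≤ g q ↔ p ≤ q)
    (h₁ : ∀ p, ∀ S ∈ J (g p), S (𝟙 _))
    (h₂ : ∀ c, ∀ S : Sieve c, (∀ p (f : g p ⟶ c), S f) → S ∈ J c) :
    Nonempty (Sheaf J (Type u) ≌ (Pᵒᵖ ⥤ Type u)) := by
  let G : P ⥤ C := Monotone.functor (f := g) fun p q h => (hg p q).2 h
  have : G.Full := ⟨fun {p q} f => ⟨homOfLE ((hg p q).1 (leOfHom f)), Subsingleton.elim _ _⟩⟩
  have : G.Faithful := ⟨fun _ => Subsingleton.elim _ _⟩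
  have : G.IsCoverDense J := ⟨fun c => h₂ c _ fun p f => ⟨⟨p, 𝟙 _, f, Subsingleton.elim _ _⟩⟩⟩
  have : G.IsDenseSubsite (⊥ : GrothendieckTopology P) J :=
    { functorPushforward_mem_iff := by
        intro p S
        rw [GrothendieckTopology.bot_covering]
        constructor
        · intro h
          obtain ⟨q, f, a, hf, -⟩ := h₁ p _ h
          have hpq : p ≤ q := (hg p q).1 (leOfHom a)
          rw [← Sieve.id_mem_iff_eq_top, ← Subsingleton.elim (homOfLE hpq ≫ f) (𝟙 p)]
          exact S.downward_closed hf _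
        · rintro rfl
          rw [Sieve.functorPushforward_top]
          exact J.top_mem _ }
  exact ⟨(Functor.IsDenseSubsite.sheafEquiv ⊥ J G (Type u)).symm.trans (sheafBotEquivalence _)⟩

/-- Subpresheaves of the terminal presheaf are lower sets. -/
def subfunctorConstOrderIso (P : Type u) [Preorder P] :
    Subfunctor ((Functor.const Pᵒᵖ).obj PUnit.{u + 1}) ≃o LowerSet P where
  toFun A := ⟨{p | PUnit.unit ∈ A.obj (op p)}, fun _ _ h hp => A.map (homOfLE h).op hp⟩
  invFun L := ⟨fun p => {_x | p.unop ∈ L}, fun f _ hx => L.lower (leOfHom f.unop) hx⟩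
  left_inv A := by ext; rfl
  right_inv L := rfl
  map_rel_iff' := ⟨fun h p _ hp => h hp, fun h p hp => h (op p) hp⟩

/-- An equivalence preserves the terminal object and its lattice of subobjects, here the lower sets;
by Birkhoff, the sup-irreducible lower sets are the principal ones, which form a copy of the poset.
-/
theorem nonempty_orderIso_of_presheaf_equiv {P Q : Type u} [PartialOrder P] [PartialOrder Q]
    [Finite P] [Finite Q] (e : (Pᵒᵖ ⥤ Type u) ≌ (Qᵒᵖ ⥤ Type u)) : Nonempty (P ≃o Q) := by
  have t : ∀ (R : Type u) [PartialOrder R],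
      Limits.IsTerminal ((Functor.const Rᵒᵖ).obj PUnit.{u + 1}) := fun R _ =>
    Limits.IsTerminal.ofUniqueHom (fun _ => { app := fun _ => ↾fun _ => PUnit.unit })
      fun _ _ => by ext; rfl
  let i := ((t P).isTerminalObj e.functor).uniqueUpToIso (t Q)
  let l : LowerSet P ≃o LowerSet Q :=
    (subfunctorConstOrderIso P).symm.trans <|
      ((Subfunctor.equivalenceMonoOver _).trans <| (MonoOver.congr _ e).trans <|
        (MonoOver.mapIso i).trans (Subfunctor.equivalenceMonoOver _).symm).toOrderIso.trans
      (subfunctorConstOrderIso Q)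
  have hl : ∀ s, SupIrred s ↔ SupIrred (l s) := fun s => by
    have key : ∀ {α β : Type u} [Lattice α] [Lattice β] (f : α ≃o β) (a : α),
        SupIrred a → SupIrred (f a) := by
      intro α β _ _ f a ha
      refine ⟨fun h => ha.1 fun b hb => ?_, fun b c h => ?_⟩
      · exact f.le_iff_le.1 (h (f.le_iff_le.2 hb))
      · have := @ha.2 (f.symm b) (f.symm c) (by rw [← map_sup, h, f.symm_apply_apply])
        simpa [OrderIso.symm_apply_eq] using this
    exact ⟨key l s, fun h => by simpa using key l.symm _ h⟩
  let m : {s : LowerSet P // SupIrred s} ≃o {s : LowerSet Q // SupIrred s} :=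
    ⟨l.toEquiv.subtypeEquiv hl, l.le_iff_le⟩
  exact ⟨OrderIso.supIrredLowerSet.trans (m.trans OrderIso.supIrredLowerSet.symm)⟩

/-! ### Finite and Alexandrov-discrete spaces -/

theorem mem_nhdsKer_self {E : Type u} [TopologicalSpace E] (x : E) : x ∈ nhdsKer {x} :=
  subset_nhdsKer rfl

theorem nhdsKer_singleton_subset_iff_mem {E : Type u} [TopologicalSpace E] {x : E} {U : Set E}
    (hU : IsOpen U) : nhdsKer {x} ⊆ U ↔ x ∈ U := by
  rw [hU.nhdsKer_subset, Set.singleton_subset_iff]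

/-- A preorder suffices, so non-T0 spaces are included. The dual appears because `x ⤳ y` means `y ≤
x` in `Specialization E`. -/
theorem nonempty_sheaf_opens_equiv_presheaf (E : Type u) [TopologicalSpace E]
    [AlexandrovDiscrete E] :
    Nonempty (Sheaf (Opens.grothendieckTopology E) (Type u) ≌
      ((Specialization E)ᵒᵈᵒᵖ ⥤ Type u)) := by
  let g : (Specialization E)ᵒᵈ → Opens E := fun x =>
    ⟨nhdsKer {Specialization.ofEquiv (OrderDual.ofDual x)}, isOpen_nhdsKer⟩
  refine nonempty_sheaf_equiv_presheaf _ g ?_ ?_ ?_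
  · intro p q
    exact specializes_iff_nhdsKer_subset.symm
  · intro p S hS
    obtain ⟨U, f, hf, hU⟩ := hS _ (mem_nhdsKer_self _)
    have h : g p ≤ U := (nhdsKer_singleton_subset_iff_mem U.isOpen).2 hU
    rw [← Subsingleton.elim (homOfLE h ≫ f) (𝟙 _)]
    exact S.downward_closed hf _
  · intro U S hS x hx
    let p : (Specialization E)ᵒᵈ := OrderDual.toDual (Specialization.toEquiv x)
    have h : g p ≤ U := (nhdsKer_singleton_subset_iff_mem U.isOpen).2 hx
    exact ⟨_, homOfLE h, hS p _, mem_nhdsKer_self x⟩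

instance (E : Type u) [Finite E] : Finite (Specialization E) := ‹Finite E›

theorem nonempty_homeomorph_of_orderIso {E F : Type u} [TopologicalSpace E] [TopologicalSpace F]
    [AlexandrovDiscrete E] [AlexandrovDiscrete F]
    (e : (Specialization E)ᵒᵈ ≃o (Specialization F)ᵒᵈ) : Nonempty (E ≃ₜ F) := by
  have c : ∀ {A B : Type u} [TopologicalSpace A] [TopologicalSpace B] [AlexandrovDiscrete A]
      [AlexandrovDiscrete B] (f : A → B), (∀ x y, x ⤳ y → f x ⤳ f y) → Continuous f := by
    intro A B _ _ _ _ f hf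
    refine ⟨fun U hU => ?_⟩
    rw [isOpen_iff_forall_specializes]
    exact fun x y h hy => (hf x y h).mem_open hU hy
  exact ⟨{  toFun := fun x => e x
            invFun := fun y => e.symm y
            left_inv := e.left_inv
            right_inv := e.right_inv
            continuous_toFun := c (A := E) (B := F) _ fun x y h => e.monotone (a := x) (b := y) h
            continuous_invFun := c (A := F) (B := E) _ fun x y h => e.symm.monotone (a := x) (b := y) h }⟩

/-- A closed irreducible set is covered by the finitely many closures of its points, hence lies in
one of them. -/
theorem isSober_of_finite (E : Type u) [TopologicalSpace E] [Finite E] [T0Space E] : IsSober E := by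
  refine ⟨⟨fun {S} hS hc => ?_⟩, ‹_›⟩
  have hfin : (S : Set E).Finite := S.toFinite
  have h := isIrreducible_iff_sUnion_isClosed.1 hS ((hfin.image fun x => closure {x}).toFinset)
    (by simp) (by
      intro x hx
      simp only [Set.Finite.coe_toFinset, Set.sUnion_image, Set.mem_iUnion]
      exact ⟨x, hx, subset_closure rfl⟩)
  simp only [Set.Finite.mem_toFinset, Set.mem_image] at h
  obtain ⟨_, ⟨x, hx, rfl⟩, h⟩ := h
  exact ⟨x, (hc.closure_subset_iff.2 (by simpa using hx)).antisymm h⟩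

/-! ### Connectivity spaces -/

namespace ConnectivityStructure

variable {X : Type u} (K : ConnectivityStructure X)

/-- The connected sets whose only covering sieve is the maximal one. -/
abbrev Irreducible : Type u := {A : K.Conn // ∀ S ∈ K.grothendieckTopology A, S (𝟙 A)}

theorem mem_grothendieckTopology_of_irreducible [Finite X] (A : K.Conn) (S : Sieve A)
    (hS : ∀ (P : K.Irreducible) (f : P.1 ⟶ A), S f) : S ∈ K.grothendieckTopology A := by
  induction A using WellFoundedLT.induction with
  | _ A ih =>
    by_cases hA : ∀ T ∈ K.grothendieckTopology A, T (𝟙 A)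
    · rw [Sieve.id_mem_iff_eq_top.1 (hS ⟨A, hA⟩ (𝟙 A))]
      exact GrothendieckTopology.top_mem _ _
    · push Not at hA
      obtain ⟨T, hT, hTA⟩ := hA
      -- The sieve `T` omits the identity, so its members are strictly smaller than `A` and
      -- induction applies to each.
      refine GrothendieckTopology.transitive _ hT S fun B f hf => ih B ?_ _ fun P g => hS P _
      refine lt_of_le_of_ne (leOfHom f) ?_
      rintro rfl
      exact hTA ((Subsingleton.elim f (𝟙 B)) ▸ hf)

theorem nonempty_sheaf_equiv_presheaf_irreducible [Finite X] :
    Nonempty (Sheaf K.grothendieckTopology (Type u) ≌ (K.Irreducibleᵒᵖ ⥤ Type u)) :=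
  nonempty_sheaf_equiv_presheaf _ (fun P : K.Irreducible => P.1) (fun _ _ => Iff.rfl)
    (fun P => P.2) fun A S hS => K.mem_grothendieckTopology_of_irreducible A S hS

/-- The connectivity structure on a topological space generated by the smallest neighbourhoods
of its points. -/
def ofSpace (E : Type u) [TopologicalSpace E] : ConnectivityStructure E :=
  generate (Set.range fun x => nhdsKer {x})

theorem nonempty_sheaf_ofSpace_equiv_presheaf (E : Type u) [TopologicalSpace E] :
    Nonempty (Sheaf (ofSpace E).grothendieckTopology (Type u) ≌
      ((Specialization E)ᵒᵈᵒᵖ ⥤ Type u)) := by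
  let g : (Specialization E)ᵒᵈ → (ofSpace E).Conn := fun x =>
    ⟨nhdsKer {Specialization.ofEquiv (OrderDual.ofDual x)}, subset_generate _ ⟨_, rfl⟩⟩
  refine nonempty_sheaf_equiv_presheaf _ g ?_ ?_ ?_
  · intro p q
    exact specializes_iff_nhdsKer_subset.symm
  · intro p S hS
    change _ = _ at hS
    have hp : (g p).1 ∈ (generate ((ofSpace E).sieveDom S)).connected := by
      rw [hS]; exact ⟨(g p).2, Set.Subset.rfl⟩
    let x : E := Specialization.ofEquiv (OrderDual.ofDual p)
    -- Testing against `L` shows that some member `D` of the sieve contains `x`, since generation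
    -- creates no new points.
    let L : ConnectivityStructure E :=
      { connected := {B | x ∈ B → ∃ D ∈ (ofSpace E).sieveDom S, x ∈ D}
        empty_mem := fun h => h.elim
        sUnion_mem := fun F hF _ ⟨B, hB, hx⟩ => hF hB hx }
    obtain ⟨D, ⟨hD, f, hf⟩, hx⟩ := hp L (fun B hB hx => ⟨B, hB, hx⟩) (mem_nhdsKer_self x)
    -- Testing against `M` shows that connected sets contain the smallest neighbourhood of each of
    -- their points, so `D` contains all of `g p`.
    let M : ConnectivityStructure E :=
      { connected := {B | ∀ y ∈ B, nhdsKer {y} ⊆ B}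
        empty_mem := fun _ h => h.elim
        sUnion_mem := fun F hF _ y ⟨B, hB, hy⟩ =>
          (hF hB y hy).trans (Set.subset_sUnion_of_mem hB) }
    have h : nhdsKer {x} ⊆ D := hD M (by
      rintro _ ⟨z, rfl⟩ y hy
      exact specializes_iff_nhdsKer_subset.1 (mem_nhdsKer_singleton.1 hy)) x hx
    have h' : g p ≤ ⟨D, hD⟩ := h
    rw [← Subsingleton.elim (homOfLE h' ≫ f) (𝟙 _)]
    exact S.downward_closed hf _
  · intro A S hS
    refine (generate_sieveDom_subset _ S).antisymm ?_
    refine (generate_inter_powerset (Set.range fun x : E => nhdsKer {x}) A.1).superset.trans ?_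
    refine generate_mono ?_
    rintro _ ⟨⟨x, rfl⟩, hx⟩
    exact ⟨_, homOfLE hx, hS (OrderDual.toDual (Specialization.toEquiv x)) _⟩

end ConnectivityStructure

theorem mainTheorem1 :
    (∀ (X : Type u) [Finite X] (K : ConnectivityStructure X),
      ∃ E : TopCat.{u},
        (Finite E ∧ IsSober E ∧
          MoritaEquivalent K.grothendieckTopology (Opens.grothendieckTopology E)) ∧
        ∀ E' : TopCat.{u}, Finite E' → IsSober E' →
          MoritaEquivalent K.grothendieckTopology (Opens.grothendieckTopology E') →
          Nonempty (E' ≃ₜ E)) ∧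
    (∀ (E : Type u) [TopologicalSpace E] [Finite E],
      ∃ (X : Type u) (_ : Finite X) (K : ConnectivityStructure X),
        MoritaEquivalent (Opens.grothendieckTopology E) K.grothendieckTopology) := by
  refine ⟨fun X _ K => ?_, fun E _ _ => ?_⟩
  · let E := Topology.WithLowerSet K.Irreducible
    have hE : Finite E := inferInstanceAs (Finite K.Irreducible)
    have : T0Space E := ⟨fun x y h => by
      rw [inseparable_iff_specializes_and] at h
      exact le_antisymm (α := K.Irreducible) (Topology.IsLowerSet.specializes_iff_le (α := E).1 h.1)
        (Topology.IsLowerSet.specializes_iff_le (α := E).1 h.2)⟩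
    obtain ⟨e⟩ := K.nonempty_sheaf_equiv_presheaf_irreducible
    obtain ⟨e₁⟩ := nonempty_sheaf_opens_equiv_presheaf E
    let i : K.Irreducible ≃o (Specialization E)ᵒᵈ :=
      { toFun := fun x => x
        invFun := fun x => x
        left_inv := fun _ => rfl
        right_inv := fun _ => rfl
        map_rel_iff' := fun {x y} =>
          Topology.IsLowerSet.specializes_iff_le (α := E) (a := x) (b := y) }
    have e₂ : Sheaf K.grothendieckTopology (Type u) ≌ Sheaf (Opens.grothendieckTopology E) (Type u) :=
      e.trans ((i.equivalence.op.congrLeft).trans e₁.symm)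
    refine ⟨TopCat.of E, ⟨hE, isSober_of_finite E, ⟨e₂⟩⟩, fun E' _ hE' ⟨e'⟩ => ?_⟩
    have := hE'.2
    obtain ⟨e₃⟩ := nonempty_sheaf_opens_equiv_presheaf E'
    obtain ⟨j⟩ := nonempty_orderIso_of_presheaf_equiv
      (e₃.symm.trans (e'.symm.trans (e₂.trans e₁)))
    exact nonempty_homeomorph_of_orderIso j
  · obtain ⟨e₁⟩ := nonempty_sheaf_opens_equiv_presheaf E
    obtain ⟨e₂⟩ := ConnectivityStructure.nonempty_sheaf_ofSpace_equiv_presheaf E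
    exact ⟨E, ‹_›, ConnectivityStructure.ofSpace E, ⟨e₁.trans e₂.symm⟩⟩
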